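/- Let $n\ge 2$ be an integer, let $\beta$ be the unique positive root of $\beta^n=1+\beta+\cdots+\beta^{n-1}$ (so $1<\beta<2$), and let $\lambda_2$ be a complex root of second largest absolute value, among all $n$ roots, of $p(x)=x^n-(1+x+\cdots+x^{n-1})$. For $x\in[0,1)$ put $t(x)=\beta x-\lfloor\beta x\rfloor$, let $t^m$ be the $m$-th iterate of $t$ ($t^0(x)=x$), and let $x_k=\lfloor\beta t^{k-1}(x)\rfloor$, $k\ge1$, be the digits of the greedy base-$\beta$ expansion of $x$. The scaled remainder is $t^m(x)=\sum_{k\ge1}x_{m+k}\beta^{-k}$. For a function $f$ on $[0,1)$ put $$(Tf)(x)=\beta^{-1}\sum_{y\in[0,1),\ t(y)=x}f(y),\qquad x\in[0,1),\qquad f_m=T^mf .$$ Let $$f_\beta(x)=\frac1{D(\beta)}\sum_{j=1}^n\bigl(\beta^j-\beta^{j-1}-\cdots-\beta\bigr)\,\mathbf 1\bigl\{\beta^{-1}+\cdots+\beta^{-(j-1)}\le x<\beta^{-1}+\cdots+\beta^{-j}\bigr\},\qquad 0\le x<1,$$ where $D(\beta)$ is the constant for which $\int_0^1f_\beta(x)\,dx=1$,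 and let $P_\beta(B)=\int_Bf_\beta(x)\,dx$ for Borel sets $B\subseteq[0,1)$. Then $f_\beta$ is a probability density on $[0,1)$ and $P_\beta$ is invariant under $t$. Let $X$ be a random variable with a probability density $f$ concentrated on $[0,1)$, and let $P_m$ be the law of $t^m(X)$. Then $f_m$ is a probability density of $P_m$ for every $m$, and $$\lim_{m\to\infty}\ \sup_{B\subseteq[0,1)\text{ Borel}}|P_m(B)-P_\beta(B)|=0 .$$ Moreover, there are constants $C_1,C_2$ depending only on $n$ such that, for every probability density $f$ on $[0,1)$ and every $L_f$ with $|f(x)-f(y)|\le L_f|x-y|$ for all $x,y\in[0,1)$, $$\sup_{x\in[0,1)}|f_m(x)-f_\beta(x)|\le C_1\,|\beta^{-1}\lambda_2|^{m_2}+C_2\,\beta^{-m_1}L_f$$ for all integers $m=m_1+m_2$ with $m_2>2n-1$ and $m_1\ge n-1$. -/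

import Mathlib

open Filter Topology MeasureTheory ProbabilityTheory Set

namespace PseudoGolden

noncomputable section

/-- The map `t(x) = βx - ⌊βx⌋`; its `m`-th iterate is the scaled remainder after `m` digits. -/
def betaMap (β x : ℝ) : ℝ := β * x - (⌊β * x⌋ : ℝ)

/-- The digits of the greedy base-`β` expansion, numbered from `0`:
`digit β k x = ⌊β t^k(x)⌋` is the digit multiplying `β^{-(k+1)}`. -/
def digit (β : ℝ) (k : ℕ) (x : ℝ) : ℤ := ⌊β * (betaMap β)^[k] x⌋

/-- `f` is (the restriction to `[0,1)` of) a probability density concentrated on `[0,1)`.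
Values of `f` outside `[0,1)` are irrelevant. -/
structure IsPDF (f : ℝ → ℝ) : Prop where
  measurable : Measurable f
  nonneg : ∀ x ∈ Ico (0 : ℝ) 1, 0 ≤ f x
  lintegral_eq_one : ∫⁻ x in Ico (0 : ℝ) 1, ENNReal.ofReal (f x) = 1

/-- The law `B ↦ ∫_{B ∩ [0,1)} f(x) dx` with density `f` on `[0,1)`. -/
def densityLaw (f : ℝ → ℝ) : Measure ℝ :=
  (volume.restrict (Ico (0 : ℝ) 1)).withDensity fun x => ENNReal.ofReal (f x)

/-- The operator `T` induced by `t` on densities on `[0,1)`, for `1 < β < 2`: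
`(Tf)(x) = β⁻¹ ∑ f(y)`, the sum being over the `y ∈ [0,1)` with `t(y) = x`,
that is, over those `y = (x + k) / β` with `k ∈ {0, 1}` that are less than `1`. -/
def transfer (β : ℝ) (f : ℝ → ℝ) (x : ℝ) : ℝ :=
  β⁻¹ * ∑ k ∈ Finset.range 2, if (x + k) / β < 1 then f ((x + k) / β) else 0

/-- The unnormalized density `∑_{j=1}^n F_j`, where
`F_j = (β^j - β^{j-1} - ⋯ - β) χ_{[β⁻¹ + ⋯ + β^{-(j-1)}, β⁻¹ + ⋯ + β^{-j})}`. -/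
def parrySum (n : ℕ) (β x : ℝ) : ℝ :=
  ∑ j ∈ Finset.Icc 1 n,
    (Ico (∑ i ∈ Finset.Ico 1 j, (β ^ i)⁻¹) (∑ i ∈ Finset.Icc 1 j, (β ^ i)⁻¹)).indicator
      (fun _ => β ^ j - ∑ i ∈ Finset.Ico 1 j, β ^ i) x

/-- The normalizing constant `D(β)`. -/
def parryConst (n : ℕ) (β : ℝ) : ℝ := ∫ x in Ico (0 : ℝ) 1, parrySum n β x

/-- The density `f_β`. -/
def parryDensity (n : ℕ) (β x : ℝ) : ℝ := parrySum n β x / parryConst n β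

/-- The total variation distance of two probability measures on `[0,1)`. -/
def tvDist (μ ν : Measure ℝ) : ℝ :=
  sSup {d | ∃ B : Set ℝ, MeasurableSet B ∧ B ⊆ Ico 0 1 ∧ d = |μ.real B - ν.real B|}

open Polynomial in
/-- The polynomial `x^n - (1 + x + ⋯ + x^{n-1})`. -/
def charPoly (n : ℕ) : ℂ[X] := X ^ n - ∑ i ∈ Finset.range n, X ^ i

/-- `z` is a root of second largest absolute value: it comes second in some enumeration of the
`n` complex roots, with multiplicity, by non-increasing absolute value. -/
def IsSecondRoot (n : ℕ) (z : ℂ) : Prop :=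
  ∃ r : Fin n → ℂ, (charPoly n).roots = Finset.univ.val.map r ∧
    Antitone (fun i => ‖r i‖) ∧ ∃ h : 1 < n, z = r ⟨1, h⟩

end

end PseudoGolden

open PseudoGolden

namespace PseudoGolden

noncomputable section

/-! The points β⁻¹ + ⋯ + β^{-j} cut [0,1) into n cells forming a Markov partition for t: the inverse
branch x/β sends [0,1) onto cell 0, and (x+1)/β sends cell j onto cell j+1, except that the last
cell has no second preimage. Hence T preserves functions constant on cells and acts on their values
as β⁻¹ times `shift` (`transfer_step`).

Each root z of the polynomial gives an eigenfunctional v ↦ ∑ z^{-(j+1)} v_j of `shift` with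
eigenvalue z (`sum_shift`); for z = β it is the integral. The roots are distinct, so these
functionals diagonalize `shift`, and step functions of integral zero decay like |λ₂/β|^m
(`exists_shift_bound`). The eigenvector for β is the unnormalized density, which is therefore fixed
by T.

For general g, both inverse branches contract by β, so m₁ iterations of T make the oscillation
inside cells at most E times the fixed density, where E bounds that of g at distances β^{-m₁}
(`oscLE_iterate_transfer`). Replacing T^{m₁}g by its cell averages costs at most E times the fixed
density, a bound that survives m₂ more steps because T is positive; the averages converge by the
spectral estimate. This is `exists_rate`. A Lipschitz density has E = L β^{-m₁}; an arbitrary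
density is approximated in L¹, where T is a contraction. -/

/-! ### The Markov partition and the transfer operator on step functions. -/

/-- `β` is the positive root of `x^n = 1 + x + ⋯ + x^{n-1}`. -/
structure IsBase (n : ℕ) (β : ℝ) : Prop where
  two_le : 2 ≤ n
  pos : 0 < β
  pow_eq : β ^ n = ∑ i ∈ Finset.range n, β ^ i

/-- The endpoints `β⁻¹ + ⋯ + β^{-j}` of the Markov partition. -/
def cut (β : ℝ) (j : ℕ) : ℝ := ∑ i ∈ Finset.range j, (β ^ (i + 1))⁻¹

/-- The cells of the Markov partition. -/
def cell (β : ℝ) (j : ℕ) : Set ℝ := Ico (cut β j) (cut β (j + 1))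

/-- The function with the constant value `v j` on the `j`-th cell. -/
def step (n : ℕ) (β : ℝ) (v : ℕ → ℝ) (x : ℝ) : ℝ :=
  ∑ j ∈ Finset.range n, (cell β j).indicator (fun _ => v j) x

/-- The values of the unnormalized invariant density. -/
def weight (β : ℝ) (j : ℕ) : ℝ := β ^ (j + 1) - ∑ i ∈ Finset.range j, β ^ (i + 1)

/-- `β` times the action of the transfer operator on the values of step functions. -/
def shift (n : ℕ) (v : ℕ → ℝ) (j : ℕ) : ℝ := v 0 + if j + 1 < n then v (j + 1) else 0

/-- Divide the equation by z^n and reverse the sum. Over ℝ this makes the cells fill [0,1); over ℂ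
it yields the eigenfunctionals. -/
lemma inv_pow_sum_eq_one {K : Type*} [Field K] {n : ℕ} {z : K} (hz : z ≠ 0)
    (h : z ^ n = ∑ i ∈ Finset.range n, z ^ i) :
    ∑ i ∈ Finset.range n, z⁻¹ ^ (i + 1) = 1 := by
  rw [← Finset.sum_range_reflect]
  have h1 : z⁻¹ ^ n * z ^ n = 1 := by rw [← mul_pow, inv_mul_cancel₀ hz, one_pow]
  rw [← h1]
  conv_rhs => rw [h, Finset.mul_sum]
  refine Finset.sum_congr rfl fun i hi => ?_
  have hi := Finset.mem_range.1 hi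
  rw [show n - 1 - i + 1 = n - i by omega]
  conv_rhs => rw [show n = (n - i) + i by omega, pow_add, mul_assoc, ← mul_pow,
    inv_mul_cancel₀ hz, one_pow, mul_one]

@[simp] lemma cut_zero (β : ℝ) : cut β 0 = 0 := by simp [cut]

lemma cut_succ (β : ℝ) (j : ℕ) : cut β (j + 1) = cut β j + (β ^ (j + 1))⁻¹ :=
  Finset.sum_range_succ _ _

lemma parrySum_eq_step (n : ℕ) (β : ℝ) : parrySum n β = step n β (weight β) := by
  have e (j : ℕ) (F : ℕ → ℝ) : ∑ i ∈ Finset.Ico 1 (j + 1), F i = ∑ i ∈ Finset.range j, F (i + 1) := by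
    rw [Finset.sum_Ico_eq_sum_range]
    simp [add_comm]
  have e' (j : ℕ) (F : ℕ → ℝ) : ∑ i ∈ Finset.Icc 1 j, F i = ∑ i ∈ Finset.range j, F (i + 1) := by
    rw [← e]; rfl
  funext x
  simp only [parrySum, step, e', e, cell, cut, weight]

namespace IsBase

variable {n : ℕ} {β : ℝ} (hb : IsBase n β)
include hb

lemma one_lt : 1 < β := by
  by_contra! h
  have h1 : β ^ n ≤ 1 := pow_le_one₀ hb.pos.le h
  have h2 : ∑ i ∈ Finset.range 2, β ^ i ≤ ∑ i ∈ Finset.range n, β ^ i :=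
    Finset.sum_le_sum_of_subset_of_nonneg (Finset.range_mono hb.two_le)
      fun i _ _ => (pow_pos hb.pos i).le
  simp only [Finset.sum_range_succ, Finset.sum_range_zero] at h2
  have := hb.pos
  have := hb.pow_eq
  linarith [pow_zero β, pow_one β]

lemma strictMono_cut : StrictMono (cut β) :=
  strictMono_nat_of_lt_succ fun j => by
    rw [cut_succ]; have := pow_pos hb.pos (j + 1); simpa using this

lemma cut_nonneg (j : ℕ) : 0 ≤ cut β j := by
  simpa using hb.strictMono_cut.monotone (Nat.zero_le j)

lemma cut_eq_one : cut β n = 1 := by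
  rw [← inv_pow_sum_eq_one hb.pos.ne' hb.pow_eq]; simp [cut]

/-- The Markov property: the branch (x+1)/β carries each endpoint to the next one. -/
lemma mul_cut_succ (j : ℕ) : β * cut β (j + 1) = 1 + cut β j := by
  have := hb.pos
  rw [cut, Finset.sum_range_succ', cut, mul_add, Finset.mul_sum, add_comm]
  congr 1
  · simp [this.ne']
  · refine Finset.sum_congr rfl fun i _ => ?_
    field_simp
    ring

/-- The second branch has domain [0, β - 1), so this domain is exactly the union of all cells but
the last. -/
lemma eq_one_add_cut : β = 1 + cut β (n - 1) := by
  rw [← hb.mul_cut_succ, Nat.sub_add_cancel (by linarith [hb.two_le]), hb.cut_eq_one, mul_one]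

lemma lt_two : β < 2 := by
  have h := hb.strictMono_cut (show n - 1 < n by have := hb.two_le; omega)
  rw [hb.cut_eq_one] at h
  linarith [hb.eq_one_add_cut]

lemma cell_subset {j : ℕ} (hj : j < n) : cell β j ⊆ Ico 0 1 := by
  intro x hx
  refine ⟨(hb.cut_nonneg j).trans hx.1, hx.2.trans_le ?_⟩
  rw [← hb.cut_eq_one]
  exact hb.strictMono_cut.monotone hj

lemma exists_mem_cell {x : ℝ} (hx : x ∈ Ico (0 : ℝ) 1) : ∃ j < n, x ∈ cell β j := by
  have hP : ∃ j, x < cut β j := ⟨n, by rw [hb.cut_eq_one]; exact hx.2⟩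
  classical
  have h0 : Nat.find hP ≠ 0 := fun h => by
    have := Nat.find_spec hP
    rw [h, cut_zero] at this
    exact absurd hx.1 (not_le.2 this)
  obtain ⟨k, hk⟩ := Nat.exists_eq_succ_of_ne_zero h0
  refine ⟨k, ?_, ?_, ?_⟩
  · have : Nat.find hP ≤ n := Nat.find_min' hP (by rw [hb.cut_eq_one]; exact hx.2)
    omega
  · exact not_lt.1 (Nat.find_min hP (by omega))
  · have := Nat.find_spec hP
    rwa [hk] at this

lemma eq_of_mem_cell {x : ℝ} {i j : ℕ} (hi : x ∈ cell β i) (hj : x ∈ cell β j) : i = j := by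
  have h1 := hb.strictMono_cut.lt_iff_lt.1 (hi.1.trans_lt hj.2)
  have h2 := hb.strictMono_cut.lt_iff_lt.1 (hj.1.trans_lt hi.2)
  omega

lemma step_of_mem {x : ℝ} {j : ℕ} (hj : j < n) (hx : x ∈ cell β j) (v : ℕ → ℝ) :
    step n β v x = v j := by
  rw [step, Finset.sum_eq_single_of_mem j (Finset.mem_range.2 hj), indicator_of_mem hx]
  intro i _ hij
  exact indicator_of_notMem (fun h => hij (hb.eq_of_mem_cell h hx)) _

lemma div_mem_cell {x : ℝ} (hx : x ∈ Ico (0 : ℝ) 1) : x / β ∈ cell β 0 := by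
  refine ⟨by rw [cut_zero]; exact div_nonneg hx.1 hb.pos.le, ?_⟩
  rw [div_lt_iff₀ hb.pos, mul_comm, hb.mul_cut_succ, cut_zero, add_zero]
  exact hx.2

lemma add_one_div_mem_cell {x : ℝ} {j : ℕ} (hx : x ∈ cell β j) :
    (x + 1) / β ∈ cell β (j + 1) := by
  constructor
  · rw [le_div_iff₀ hb.pos, mul_comm, hb.mul_cut_succ]; linarith [hx.1]
  · rw [div_lt_iff₀ hb.pos, mul_comm, hb.mul_cut_succ]; linarith [hx.2]

lemma transfer_of_mem_Ico {x : ℝ} (hx : x ∈ Ico (0 : ℝ) 1) (f : ℝ → ℝ) :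
    transfer β f x = β⁻¹ * (f (x / β) + if x < β - 1 then f ((x + 1) / β) else 0) := by
  have h0 : x / β < 1 := by rw [div_lt_one hb.pos]; linarith [hx.2, hb.one_lt]
  have h1 : (x + 1) / β < 1 ↔ x < β - 1 := by rw [div_lt_one hb.pos, lt_sub_iff_add_lt]
  simp [transfer, Finset.sum_range_succ, h0, h1]

lemma transfer_of_mem_cell {x : ℝ} {j : ℕ} (hj : j < n) (hx : x ∈ cell β j) (f : ℝ → ℝ) :
    transfer β f x = β⁻¹ * (f (x / β) + if j + 1 < n then f ((x + 1) / β) else 0) := by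
  rw [hb.transfer_of_mem_Ico (hb.cell_subset hj hx)]
  have h : x < β - 1 ↔ j + 1 < n := by
    rw [hb.eq_one_add_cut, add_sub_cancel_left]
    constructor
    · intro h
      have := hb.strictMono_cut.lt_iff_lt.1 (hx.1.trans_lt h)
      omega
    · intro h
      exact hx.2.trans_le (hb.strictMono_cut.monotone (by omega))
  simp only [h]

lemma transfer_step {x : ℝ} (hx : x ∈ Ico (0 : ℝ) 1) (v : ℕ → ℝ) :
    transfer β (step n β v) x = β⁻¹ * step n β (shift n v) x := by
  obtain ⟨j, hj, hxj⟩ := hb.exists_mem_cell hx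
  rw [hb.transfer_of_mem_cell hj hxj, hb.step_of_mem hj hxj,
    hb.step_of_mem (by linarith [hb.two_le]) (hb.div_mem_cell hx), shift]
  split_ifs with h
  · rw [hb.step_of_mem h (hb.add_one_div_mem_cell hxj)]
  · rfl

omit hb in
lemma weight_succ (j : ℕ) : weight β (j + 1) = β * weight β j - β := by
  rw [weight, Finset.sum_range_succ', weight]
  have : ∑ i ∈ Finset.range j, β ^ (i + 1 + 1) = β * ∑ i ∈ Finset.range j, β ^ (i + 1) := by
    rw [Finset.mul_sum]
    exact Finset.sum_congr rfl fun i _ => by ring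
  rw [this]; ring

lemma weight_eq_zero : weight β n = 0 := by
  have : ∑ i ∈ Finset.range n, β ^ (i + 1) = β * ∑ i ∈ Finset.range n, β ^ i := by
    rw [Finset.mul_sum]
    exact Finset.sum_congr rfl fun i _ => by ring
  rw [weight, this, ← hb.pow_eq]; ring

/-- The recursion `weight_succ` is the eigenvector equation; at the last index, where `shift` drops
a term, it closes up because `weight β n` vanishes. -/
lemma shift_weight {j : ℕ} (hj : j < n) : shift n (weight β) j = β * weight β j := by
  have h0 : weight β 0 = β := by simp [weight]
  rw [shift, h0]
  split_ifs with h
  · rw [weight_succ]; ring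
  · have h1 : j + 1 = n := by omega
    have h2 := weight_succ (β := β) j
    rw [h1, hb.weight_eq_zero] at h2
    linarith

/-- Since `weight β (j + 1)` is β(`weight β j` - 1), nonnegativity at j+1 gives the bound at j; the
downward induction starts from the zero at n. -/
lemma one_le_weight {j : ℕ} (hj : j < n) : 1 ≤ weight β j := by
  obtain ⟨k, rfl⟩ : ∃ k, n = j + 1 + k := ⟨n - (j + 1), by omega⟩
  have nonneg : ∀ i l, l + i = j + 1 + k → 0 ≤ weight β l := by
    intro i
    induction i with
    | zero => intro l hl; rw [show l = j + 1 + k by omega, hb.weight_eq_zero]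
    | succ i ih =>
      intro l hl
      have h1 := ih (l + 1) (by omega)
      rw [weight_succ] at h1
      by_contra! h2
      nlinarith [hb.pos]
  have h := nonneg k (j + 1) rfl
  rw [weight_succ] at h
  by_contra! h2
  nlinarith [hb.pos]

lemma transfer_parrySum {x : ℝ} (hx : x ∈ Ico (0 : ℝ) 1) :
    transfer β (parrySum n β) x = parrySum n β x := by
  rw [parrySum_eq_step, hb.transfer_step hx]
  obtain ⟨j, hj, hxj⟩ := hb.exists_mem_cell hx
  rw [hb.step_of_mem hj hxj, hb.step_of_mem hj hxj, hb.shift_weight hj,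
    inv_mul_cancel_left₀ hb.pos.ne']

lemma one_le_parrySum {x : ℝ} (hx : x ∈ Ico (0 : ℝ) 1) : 1 ≤ parrySum n β x := by
  obtain ⟨j, hj, hxj⟩ := hb.exists_mem_cell hx
  rw [parrySum_eq_step, hb.step_of_mem hj hxj]
  exact hb.one_le_weight hj

lemma weight_le {j : ℕ} (hj : j < n) : weight β j ≤ β ^ n := by
  have h1 : β ^ (j + 1) ≤ β ^ n := pow_le_pow_right₀ hb.one_lt.le hj
  have h2 : 0 ≤ ∑ i ∈ Finset.range j, β ^ (i + 1) :=
    Finset.sum_nonneg fun i _ => (pow_pos hb.pos _).le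
  rw [weight]; linarith

lemma parrySum_le {x : ℝ} (hx : x ∈ Ico (0 : ℝ) 1) : parrySum n β x ≤ β ^ n := by
  obtain ⟨j, hj, hxj⟩ := hb.exists_mem_cell hx
  rw [parrySum_eq_step, hb.step_of_mem hj hxj]
  exact hb.weight_le hj

/-! ### The spectrum of the shift. -/

omit hb in
/-- The eigenfunctionals of `shift`. -/
lemma sum_shift {z : ℂ} (hn : 1 ≤ n) (hz : z ≠ 0) (h : z ^ n = ∑ i ∈ Finset.range n, z ^ i)
    (v : ℕ → ℝ) :
    ∑ j ∈ Finset.range n, z⁻¹ ^ (j + 1) * (shift n v j : ℂ) =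
      z * ∑ j ∈ Finset.range n, z⁻¹ ^ (j + 1) * (v j : ℂ) := by
  have h1 := inv_pow_sum_eq_one hz h
  obtain ⟨k, rfl⟩ : ∃ k, n = k + 1 := ⟨n - 1, by omega⟩
  have e1 : ∑ j ∈ Finset.range (k + 1), z⁻¹ ^ (j + 1) * (shift (k + 1) v j : ℂ) =
      v 0 + ∑ j ∈ Finset.range k, z⁻¹ ^ (j + 1) * (v (j + 1) : ℂ) := by
    simp only [shift, Complex.ofReal_add, mul_add, Finset.sum_add_distrib]
    rw [← Finset.sum_mul, h1, one_mul, Finset.sum_range_succ]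
    simp only [lt_irrefl, if_false, Complex.ofReal_zero, mul_zero, add_zero]
    congr 1
    refine Finset.sum_congr rfl fun j hj => ?_
    rw [if_pos (by simpa using hj)]
  rw [e1, Finset.mul_sum, Finset.sum_range_succ']
  rw [add_comm]
  congr 1
  · refine Finset.sum_congr rfl fun j _ => ?_
    rw [pow_succ z⁻¹ (j + 1)]
    field_simp
  · simp [hz]

/-- The positive root dominates all the others. -/
lemma norm_le_of_root {z : ℂ} (h : z ^ n = ∑ i ∈ Finset.range n, z ^ i) : ‖z‖ ≤ β := by
  by_contra! hlt
  have hz : 0 < ‖z‖ := hb.pos.trans hlt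
  have h1 : ‖z‖ ^ n ≤ ∑ i ∈ Finset.range n, ‖z‖ ^ i := by
    rw [← norm_pow, h]
    exact (norm_sum_le _ _).trans_eq (by simp)
  have h2 := inv_pow_sum_eq_one hb.pos.ne' hb.pow_eq
  -- The sum of reciprocal powers is strictly decreasing and equals 1 at β, so it is below 1 at ‖z‖
  -- > β, against the triangle inequality.
  have h3 : ∑ i ∈ Finset.range n, ‖z‖⁻¹ ^ (i + 1) < 1 := by
    rw [← h2]
    refine Finset.sum_lt_sum_of_nonempty ⟨0, Finset.mem_range.2 (by linarith [hb.two_le])⟩ ?_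
    intro i _
    exact pow_lt_pow_left₀ (inv_strictAnti₀ hb.pos hlt) (inv_pos.2 hz).le (by omega)
  have h4 : ∑ i ∈ Finset.range n, ‖z‖ ^ i = ‖z‖ ^ n * ∑ i ∈ Finset.range n, ‖z‖⁻¹ ^ (i + 1) := by
    rw [← Finset.sum_range_reflect, Finset.mul_sum]
    refine Finset.sum_congr rfl fun i hi => ?_
    have hi := Finset.mem_range.1 hi
    conv_rhs => rw [show n = (n - 1 - i) + (i + 1) by omega]
    rw [pow_add, mul_assoc, ← mul_pow, mul_inv_cancel₀ hz.ne', one_pow, mul_one]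
  rw [h4] at h1
  have := pow_pos hz n
  nlinarith

/-- The triangle inequality for ∑ z^i must be an equality. The terms 1 and z alone then give ‖z + 1‖
≥ 1 + ‖z‖, which forces z to be real and positive. -/
lemma eq_of_root_of_norm_eq {z : ℂ} (h : z ^ n = ∑ i ∈ Finset.range n, z ^ i) (hz : ‖z‖ = β) :
    z = β := by
  obtain ⟨k, hk⟩ : ∃ k, n = k + 2 := ⟨n - 2, by have := hb.two_le; omega⟩
  have h1 : ‖∑ i ∈ Finset.range n, z ^ i‖ = ∑ i ∈ Finset.range n, β ^ i := by
    rw [← h, norm_pow, hz, hb.pow_eq]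
  rw [hk, Finset.sum_range_succ', Finset.sum_range_succ', Finset.sum_range_succ',
    Finset.sum_range_succ'] at h1
  simp only [zero_add, pow_zero, pow_one] at h1
  have h2 : ‖∑ i ∈ Finset.range k, z ^ (i + 1 + 1)‖ ≤ ∑ i ∈ Finset.range k, β ^ (i + 1 + 1) :=
    (norm_sum_le _ _).trans_eq (by simp [hz])
  have h3 : 1 + β ≤ ‖z + 1‖ := by
    have := norm_add_le (∑ i ∈ Finset.range k, z ^ (i + 1 + 1)) (z + 1)
    rw [← add_assoc] at this
    linarith
  have h4 : (1 + β) ^ 2 ≤ ‖z + 1‖ ^ 2 := pow_le_pow_left₀ (by linarith [hb.pos]) h3 2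
  have h5 : ‖z‖ ^ 2 = β ^ 2 := by rw [hz]
  rw [← Complex.normSq_eq_norm_sq, Complex.normSq_apply] at h4 h5
  simp only [Complex.add_re, Complex.add_im, Complex.one_re, Complex.one_im, add_zero] at h4
  have h6 : β ≤ z.re := by nlinarith
  have h7 : z.re ≤ β := hz ▸ Complex.re_le_norm z
  have h8 : z.re = β := le_antisymm h7 h6
  have h9 : z.im = 0 := by
    have : z.im * z.im = 0 := by rw [h8] at h5; nlinarith
    simpa using this
  exact Complex.ext (by simpa using h8) (by simpa using h9)

end IsBase

section CharPoly

open Polynomial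

lemma isRoot_charPoly {n : ℕ} {z : ℂ} :
    (charPoly n).IsRoot z ↔ z ^ n = ∑ i ∈ Finset.range n, z ^ i := by
  rw [IsRoot.def, charPoly, eval_sub, eval_finsetSum, sub_eq_zero]
  simp

lemma charPoly_degree_lt (n : ℕ) :
    (∑ i ∈ Finset.range n, (X : ℂ[X]) ^ i).degree < (n : WithBot ℕ) := by
  refine (degree_sum_le _ _).trans_lt ((Finset.sup_lt_iff (WithBot.bot_lt_coe n)).2 ?_)
  intro i hi
  rw [degree_X_pow]
  exact Nat.cast_lt.2 (Finset.mem_range.1 hi)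

lemma charPoly_monic (n : ℕ) : (charPoly n).Monic :=
  monic_X_pow_sub (by
    cases n with
    | zero => simp
    | succ k => exact charPoly_degree_lt _)

/-- Differentiating (X - 1)p = X^{n+1} - 2X^n + 1 shows that a multiple root must be the positive
real 2n/(n+1). But n p(x) - x p'(x) = -∑ (n-i) x^i is negative for x > 0, so p and p' cannot both
vanish there. -/
lemma charPoly_roots_nodup {n : ℕ} (hn : 2 ≤ n) : (charPoly n).roots.Nodup := by
  rw [Multiset.nodup_iff_count_le_one]
  intro z
  rw [count_roots]
  by_contra! h
  rw [one_lt_rootMultiplicity_iff_isRoot (charPoly_monic n).ne_zero] at h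
  obtain ⟨h1, h2⟩ := h
  have hmul : (X - 1) * charPoly n = X ^ (n + 1) - 2 * X ^ n + 1 := by
    rw [charPoly, mul_sub, mul_geom_sum]; ring
  have hder := congrArg (fun q => eval z (derivative q)) hmul
  simp only [derivative_mul, derivative_add, derivative_sub, derivative_X, derivative_one,
    derivative_X_pow, eval_add, eval_mul, eval_sub, eval_X, eval_one, eval_pow, eval_C,
    h1.eq_zero, h2.eq_zero, derivative_ofNat, eval_zero, eval_ofNat] at hder
  have hz0 : z ≠ 0 := by
    rintro rfl
    have := isRoot_charPoly.1 h1
    obtain ⟨k, rfl⟩ : ∃ k, n = k + 1 := ⟨n - 1, by omega⟩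
    rw [Finset.sum_range_succ'] at this
    simp at this
  have hz : z = ((2 * n / (n + 1) : ℝ) : ℂ) := by
    obtain ⟨k, rfl⟩ : ∃ k, n = k + 1 := ⟨n - 1, by omega⟩
    have hk : z ^ k ≠ 0 := pow_ne_zero _ hz0
    have h3 : z ^ k * ((k + 1 + 1) * z - 2 * (k + 1)) = 0 := by
      simp only [Nat.add_sub_cancel, pow_succ] at hder
      push_cast at hder
      linear_combination -hder
    have h4 := (mul_eq_zero.1 h3).resolve_left hk
    have h5 : ((k : ℂ) + 1 + 1) ≠ 0 := by exact_mod_cast (by omega : k + 1 + 1 ≠ 0)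
    push_cast
    rw [eq_div_iff h5]
    linear_combination h4
  have hx : (0 : ℝ) < 2 * n / (n + 1) := by
    have : (0 : ℝ) < n := by exact_mod_cast (by omega : 0 < n)
    positivity
  generalize (2 * n / (n + 1) : ℝ) = x at hz hx
  subst hz
  have hp := isRoot_charPoly.1 h1
  have hq := h2.eq_zero
  rw [charPoly, derivative_sub, eval_sub, derivative_sum, eval_finsetSum] at hq
  simp only [derivative_X_pow, eval_mul, eval_C, eval_pow, eval_X] at hq
  have hp' : x ^ n = ∑ i ∈ Finset.range n, x ^ i := by exact_mod_cast hp
  have hq' : n * x ^ (n - 1) - ∑ i ∈ Finset.range n, i * x ^ (i - 1) = 0 := by exact_mod_cast hq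
  have e (i : ℕ) : x * (i * x ^ (i - 1)) = i * x ^ i := by
    cases i with
    | zero => simp
    | succ i => simp only [Nat.add_sub_cancel]; ring
  have hs : ∑ i ∈ Finset.range n, ((n : ℝ) - i) * x ^ i = 0 := by
    have := congrArg (x * ·) hq'
    simp only [mul_sub, mul_zero, Finset.mul_sum, e, hp'] at this
    simp only [sub_mul, Finset.sum_sub_distrib]
    exact this
  have hpos : 0 < ∑ i ∈ Finset.range n, ((n : ℝ) - i) * x ^ i :=
    Finset.sum_pos (fun i hi => mul_pos (sub_pos.2 (by exact_mod_cast Finset.mem_range.1 hi))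
      (pow_pos hx i)) ⟨0, Finset.mem_range.2 (by omega)⟩
  exact hpos.ne' hs

end CharPoly

/-- The roots are simple, the first one is `β`, and the second one bounds all the others. -/
lemma IsBase.exists_roots {n : ℕ} {β : ℝ} (hb : IsBase n β) {l : ℂ} (hl : IsSecondRoot n l) :
    ‖l‖ < β ∧ ∃ r : Fin n → ℂ, Function.Injective r ∧
      (∀ i, r i ^ n = ∑ k ∈ Finset.range n, r i ^ k) ∧ ∀ i, r i = β ∨ ‖r i‖ ≤ ‖l‖ := by
  obtain ⟨r, hr, hanti, h1, rfl⟩ := hl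
  have hinj : Function.Injective r := by
    have := charPoly_roots_nodup hb.two_le
    rw [hr] at this
    exact fun i j hij => Multiset.inj_on_of_nodup_map this i (Finset.mem_univ i) j
      (Finset.mem_univ j) hij
  have hmem (z : ℂ) : z ^ n = ∑ k ∈ Finset.range n, z ^ k ↔ ∃ i, r i = z := by
    rw [← isRoot_charPoly, ← Polynomial.mem_roots (charPoly_monic n).ne_zero, hr]
    simp
  have hroot (i) : r i ^ n = ∑ k ∈ Finset.range n, r i ^ k := (hmem _).2 ⟨i, rfl⟩
  obtain ⟨i, hi⟩ := (hmem β).1 (by exact_mod_cast hb.pow_eq)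
  have h0 : r ⟨0, by omega⟩ = β := by
    -- β occurs somewhere in the enumeration, so the first entry has norm at least β and must be β
    -- itself.
    refine hb.eq_of_root_of_norm_eq (hroot _) (le_antisymm (hb.norm_le_of_root (hroot _)) ?_)
    have : ‖r i‖ ≤ ‖r ⟨0, by omega⟩‖ := hanti (Fin.mk_le_of_le_val (Nat.zero_le _))
    rw [hi] at this
    simpa [abs_of_pos hb.pos] using this
  refine ⟨lt_of_le_of_ne (hb.norm_le_of_root (hroot _)) fun h => ?_, r, hinj, hroot, fun j => ?_⟩
  · have := hinj ((hb.eq_of_root_of_norm_eq (hroot _) h).trans h0.symm)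
    simp at this
  · by_cases hj : j = ⟨0, by omega⟩
    · left; rw [hj, h0]
    · right
      refine hanti ?_
      rw [Fin.le_def]
      have : j.val ≠ 0 := fun h => hj (Fin.ext h)
      simpa using Nat.one_le_iff_ne_zero.2 this

open Matrix in
/-- Exponential decay of `shift` on the complement of its dominant eigenvector. -/
lemma IsBase.exists_shift_bound {n : ℕ} {β : ℝ} (hb : IsBase n β) {l : ℂ}
    (hl : IsSecondRoot n l) :
    ∃ C : ℝ, 0 ≤ C ∧ ∀ (v : ℕ → ℝ) (B : ℝ), (∀ j < n, |v j| ≤ B) →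
      ∑ j ∈ Finset.range n, v j * (β ^ (j + 1))⁻¹ = 0 →
      ∀ m, ∀ j < n, |(shift n)^[m] v j| ≤ C * B * ‖l‖ ^ m := by
  obtain ⟨-, r, hinj, hroot, hle⟩ := hb.exists_roots hl
  have hn : 1 ≤ n := by linarith [hb.two_le]
  have hr0 (i) : r i ≠ 0 := by
    intro h0
    have := hroot i
    obtain ⟨k, hk⟩ : ∃ k, n = k + 1 := ⟨n - 1, by omega⟩
    rw [h0, hk, Finset.sum_range_succ'] at this
    simp at this
  -- The rows are the eigenfunctionals; up to a diagonal factor this is the Vandermonde matrix of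
  -- the distinct reciprocals, hence invertible.
  set V : Matrix (Fin n) (Fin n) ℂ := of fun i j => (r i)⁻¹ ^ (j.val + 1) with hV
  have hVeq : V = diagonal (fun i => (r i)⁻¹) * vandermonde fun i => (r i)⁻¹ := by
    ext i j
    rw [diagonal_mul, vandermonde_apply, hV, of_apply, pow_succ']
  have hdet : IsUnit V.det := by
    rw [isUnit_iff_ne_zero, hVeq, det_mul, det_diagonal]
    refine mul_ne_zero (Finset.prod_ne_zero_iff.2 fun i _ => inv_ne_zero (hr0 i))
      (det_vandermonde_ne_zero_iff.2 fun i j hij => hinj (inv_injective hij))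
  set W := V⁻¹
  have hWV : W * V = 1 := nonsing_inv_mul V hdet
  let u (v : ℕ → ℝ) : Fin n → ℂ := fun j => v j
  have hu (v : ℕ → ℝ) (i) :
      (V *ᵥ u v) i = ∑ j ∈ Finset.range n, (r i)⁻¹ ^ (j + 1) * (v j : ℂ) := by
    rw [Finset.sum_range]; rfl
  have hiter (v : ℕ → ℝ) (i) (m : ℕ) : (V *ᵥ u ((shift n)^[m] v)) i = r i ^ m * (V *ᵥ u v) i := by
    induction m with
    | zero => simp
    | succ m ih =>
      rw [Function.iterate_succ_apply', hu, IsBase.sum_shift hn (hr0 i) (hroot i), ← hu, ih]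
      ring
  refine ⟨∑ j, ∑ i, ‖W j i‖ * ∑ k, ‖V i k‖, by positivity, fun v B hB h0 m j hj => ?_⟩
  have hB0 : 0 ≤ B := (abs_nonneg _).trans (hB j hj)
  have hVu (i) : ‖r i ^ m * (V *ᵥ u v) i‖ ≤ ‖l‖ ^ m * ((∑ k, ‖V i k‖) * B) := by
    rcases hle i with h | h
    -- The coordinate belonging to β is the integral, which is zero by assumption.
    · have : (V *ᵥ u v) i = 0 := by
        rw [hu, h]
        have := congrArg (fun x : ℝ => (x : ℂ)) h0
        push_cast at this
        rw [← this]
        refine Finset.sum_congr rfl fun k _ => ?_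
        rw [inv_pow, mul_comm]
      rw [this, mul_zero, norm_zero]
      positivity
    · rw [norm_mul, norm_pow]
      refine mul_le_mul (pow_le_pow_left₀ (norm_nonneg _) h m) ?_ (norm_nonneg _) (by positivity)
      rw [Finset.sum_mul, mulVec, dotProduct]
      refine (norm_sum_le _ _).trans (Finset.sum_le_sum fun k _ => ?_)
      rw [norm_mul]
      refine mul_le_mul_of_nonneg_left ?_ (norm_nonneg _)
      simpa [u] using hB k k.2
  have hinv : u ((shift n)^[m] v) = W *ᵥ (V *ᵥ u ((shift n)^[m] v)) := by
    rw [mulVec_mulVec, hWV, one_mulVec]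
  have hj' := congrFun hinv ⟨j, hj⟩
  have h1 : |(shift n)^[m] v j| = ‖u ((shift n)^[m] v) ⟨j, hj⟩‖ := by simp [u]
  rw [h1, hj', mulVec, dotProduct]
  calc ‖∑ i, W ⟨j, hj⟩ i * (V *ᵥ u ((shift n)^[m] v)) i‖
    _ ≤ ∑ i, ‖W ⟨j, hj⟩ i‖ * (‖l‖ ^ m * ((∑ k, ‖V i k‖) * B)) := by
        refine (norm_sum_le _ _).trans (Finset.sum_le_sum fun i _ => ?_)
        rw [norm_mul, hiter]
        exact mul_le_mul_of_nonneg_left (hVu i) (norm_nonneg _)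
    _ = (∑ i, ‖W ⟨j, hj⟩ i‖ * ∑ k, ‖V i k‖) * B * ‖l‖ ^ m := by
        rw [Finset.sum_mul, Finset.sum_mul]
        exact Finset.sum_congr rfl fun i _ => by ring
    _ ≤ _ := by
        refine mul_le_mul_of_nonneg_right (mul_le_mul_of_nonneg_right ?_ hB0) (by positivity)
        exact Finset.single_le_sum (f := fun j => ∑ i, ‖W j i‖ * ∑ k, ‖V i k‖)
          (fun j _ => by positivity) (Finset.mem_univ (⟨j, hj⟩ : Fin n))

/-! ### Linearity, positivity and smoothing of the transfer operator. -/

lemma measurable_betaMap (β : ℝ) : Measurable (betaMap β) := by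
  unfold betaMap
  fun_prop

lemma betaMap_mem (β x : ℝ) : betaMap β x ∈ Ico (0 : ℝ) 1 :=
  ⟨Int.fract_nonneg (β * x), Int.fract_lt_one (β * x)⟩

lemma measurable_transfer (β : ℝ) {f : ℝ → ℝ} (hf : Measurable f) :
    Measurable (transfer β f) := by
  unfold transfer
  refine measurable_const.mul (Finset.measurable_sum _ fun k _ => ?_)
  have h : Measurable fun x : ℝ => (x + k) / β := by fun_prop
  exact Measurable.ite (measurableSet_lt h measurable_const) (hf.comp h) measurable_const

lemma transfer_sub (β : ℝ) (f g : ℝ → ℝ) :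
    transfer β (f - g) = transfer β f - transfer β g := by
  funext x
  simp only [transfer, Finset.sum_range_succ, Finset.sum_range_zero, Pi.sub_apply]
  split_ifs <;> ring

lemma transfer_smul (β c : ℝ) (f : ℝ → ℝ) : transfer β (c • f) = c • transfer β f := by
  funext x
  simp only [transfer, Finset.sum_range_succ, Finset.sum_range_zero, Pi.smul_apply, smul_eq_mul]
  split_ifs <;> ring

lemma iterate_transfer_sub (β : ℝ) (f g : ℝ → ℝ) (m : ℕ) :
    (transfer β)^[m] (f - g) = (transfer β)^[m] f - (transfer β)^[m] g := by
  induction m with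
  | zero => rfl
  | succ m ih => simp only [Function.iterate_succ_apply', ih, transfer_sub]

lemma iterate_transfer_smul (β c : ℝ) (f : ℝ → ℝ) (m : ℕ) :
    (transfer β)^[m] (c • f) = c • (transfer β)^[m] f := by
  induction m with
  | zero => rfl
  | succ m ih => simp only [Function.iterate_succ_apply', ih, transfer_smul]

lemma measurable_step (n : ℕ) (β : ℝ) (v : ℕ → ℝ) : Measurable (step n β v) :=
  Finset.measurable_sum _ fun _ _ => measurable_const.indicator measurableSet_Ico

/-- The oscillation of `g` inside the cells, at distances up to `δ`, is at most `E` times the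
invariant density. -/
def OscLE (n : ℕ) (β : ℝ) (g : ℝ → ℝ) (δ E : ℝ) : Prop :=
  ∀ j < n, ∀ x ∈ cell β j, ∀ y ∈ cell β j, |x - y| ≤ δ → |g x - g y| ≤ E * parrySum n β x

namespace IsBase

variable {n : ℕ} {β : ℝ} (hb : IsBase n β)
include hb

lemma div_mem_Ico {x : ℝ} (hx : x ∈ Ico (0 : ℝ) 1) : x / β ∈ Ico (0 : ℝ) 1 :=
  hb.cell_subset (by linarith [hb.two_le]) (hb.div_mem_cell hx)

lemma add_one_div_mem_Ico {x : ℝ} (hx : x ∈ Ico (0 : ℝ) 1) (h : x < β - 1) :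
    (x + 1) / β ∈ Ico (0 : ℝ) 1 := by
  refine ⟨div_nonneg (by linarith [hx.1]) hb.pos.le, ?_⟩
  rw [div_lt_one hb.pos]; linarith

lemma transfer_congr {f g : ℝ → ℝ} (h : EqOn f g (Ico 0 1)) :
    EqOn (transfer β f) (transfer β g) (Ico 0 1) := by
  intro x hx
  rw [hb.transfer_of_mem_Ico hx, hb.transfer_of_mem_Ico hx, h (hb.div_mem_Ico hx)]
  split_ifs with h1
  · rw [h (hb.add_one_div_mem_Ico hx h1)]
  · rfl

lemma iterate_transfer_congr {f g : ℝ → ℝ} (h : EqOn f g (Ico 0 1)) (m : ℕ) :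
    EqOn ((transfer β)^[m] f) ((transfer β)^[m] g) (Ico 0 1) := by
  induction m with
  | zero => exact h
  | succ m ih => simp only [Function.iterate_succ_apply']; exact hb.transfer_congr ih

lemma iterate_transfer_of_fixed {f : ℝ → ℝ} (h : EqOn (transfer β f) f (Ico 0 1)) (m : ℕ) :
    EqOn ((transfer β)^[m] f) f (Ico 0 1) := by
  induction m with
  | zero => exact fun _ _ => rfl
  | succ m ih =>
    rw [Function.iterate_succ_apply']
    exact (hb.transfer_congr ih).trans h

lemma abs_transfer_le {f g : ℝ → ℝ} (h : ∀ x ∈ Ico (0 : ℝ) 1, |f x| ≤ g x) :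
    ∀ x ∈ Ico (0 : ℝ) 1, |transfer β f x| ≤ transfer β g x := by
  intro x hx
  have hβ := inv_pos.2 hb.pos
  rw [hb.transfer_of_mem_Ico hx, hb.transfer_of_mem_Ico hx, abs_mul, abs_of_pos hβ]
  refine mul_le_mul_of_nonneg_left ((abs_add_le _ _).trans (add_le_add (h _ (hb.div_mem_Ico hx)) ?_))
    hβ.le
  split_ifs with h1
  · exact h _ (hb.add_one_div_mem_Ico hx h1)
  · simp

lemma abs_iterate_transfer_le {f g : ℝ → ℝ} (h : ∀ x ∈ Ico (0 : ℝ) 1, |f x| ≤ g x) (m : ℕ) :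
    ∀ x ∈ Ico (0 : ℝ) 1, |(transfer β)^[m] f x| ≤ (transfer β)^[m] g x := by
  induction m with
  | zero => exact h
  | succ m ih => simp only [Function.iterate_succ_apply']; exact hb.abs_transfer_le ih

lemma transfer_nonneg {f : ℝ → ℝ} (h : ∀ x ∈ Ico (0 : ℝ) 1, 0 ≤ f x) :
    ∀ x ∈ Ico (0 : ℝ) 1, 0 ≤ transfer β f x := fun x hx =>
  (abs_nonneg _).trans (hb.abs_transfer_le (fun y hy => (abs_of_nonneg (h y hy)).le) x hx)

lemma iterate_transfer_step (v : ℕ → ℝ) (m : ℕ) :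
    EqOn ((transfer β)^[m] (step n β v)) ((β⁻¹ ^ m) • step n β ((shift n)^[m] v)) (Ico 0 1) := by
  induction m with
  | zero => intro x _; simp
  | succ m ih =>
    intro x hx
    simp only [Function.iterate_succ_apply']
    rw [hb.transfer_congr ih hx, transfer_smul]
    simp only [Pi.smul_apply, smul_eq_mul]
    rw [hb.transfer_step hx, pow_succ, mul_assoc]

lemma iterate_transfer_parrySum (m : ℕ) :
    EqOn ((transfer β)^[m] (parrySum n β)) (parrySum n β) (Ico 0 1) :=
  hb.iterate_transfer_of_fixed (fun _ hx => hb.transfer_parrySum hx) m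

/-- Each inverse branch keeps a cell inside one cell and divides distances by β. Writing the
majorant as its own image under T splits it over the same branches, so E does not grow. -/
lemma oscLE_transfer {g : ℝ → ℝ} {δ E : ℝ} (h : OscLE n β g δ E) :
    OscLE n β (transfer β g) (β * δ) E := by
  intro j hj x hx y hy hxy
  have hβ := hb.pos
  have h0 : 0 < n := by linarith [hb.two_le]
  have hx' := hb.cell_subset hj hx
  have hy' := hb.cell_subset hj hy
  rw [← hb.transfer_parrySum hx', hb.transfer_of_mem_cell hj hx, hb.transfer_of_mem_cell hj hy,
    hb.transfer_of_mem_cell hj hx, ← mul_sub, abs_mul, abs_of_pos (inv_pos.2 hβ),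
    mul_left_comm]
  refine mul_le_mul_of_nonneg_left ?_ (inv_pos.2 hβ).le
  have hd : |x - y| / β ≤ δ := by rwa [div_le_iff₀ hβ, mul_comm]
  have h1 := h 0 h0 _ (hb.div_mem_cell hx') _ (hb.div_mem_cell hy')
    (by rwa [← sub_div, abs_div, abs_of_pos hβ])
  rw [add_sub_add_comm, mul_add]
  refine (abs_add_le _ _).trans (add_le_add h1 ?_)
  split_ifs with hj1
  · exact h (j + 1) hj1 _ (hb.add_one_div_mem_cell hx) _ (hb.add_one_div_mem_cell hy)
      (by rwa [← sub_div, abs_div, abs_of_pos hβ, add_sub_add_right_eq_sub])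
  · simp

lemma oscLE_iterate_transfer {g : ℝ → ℝ} {δ E : ℝ} (h : OscLE n β g δ E) (m : ℕ) :
    OscLE n β ((transfer β)^[m] g) (β ^ m * δ) E := by
  induction m with
  | zero => simpa using h
  | succ m ih =>
    rw [Function.iterate_succ_apply', pow_succ', mul_assoc]
    exact hb.oscLE_transfer ih

/-! ### Integrals, L¹ contraction and cell averages. -/

omit hb in
lemma integrableOn_Ico_zero_one_iff {f : ℝ → ℝ} :
    IntegrableOn f (Ico 0 1) ↔ IntervalIntegrable f volume 0 1 :=
  (intervalIntegrable_iff_integrableOn_Ico_of_le zero_le_one).symm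

/-- Change of variables on each branch: the images x/β and (x+1)/β fill [0, β⁻¹) and [β⁻¹, 1). -/
lemma integral_transfer {f : ℝ → ℝ} (hf : IntegrableOn f (Ico 0 1)) :
    IntegrableOn (transfer β f) (Ico 0 1) ∧
      ∫ x in Ico (0 : ℝ) 1, transfer β f x = ∫ x in Ico (0 : ℝ) 1, f x := by
  have hβ := hb.pos
  have hβ1 := hb.one_lt
  have hβ2 := hb.lt_two
  have hinv : β⁻¹ ≤ 1 := inv_le_one_of_one_le₀ hβ1.le
  have hinv0 : 0 ≤ β⁻¹ := (inv_pos.2 hβ).le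
  have ico {a b : ℝ} (h : a ≤ b) (F : ℝ → ℝ) : ∫ x in Ico a b, F x = ∫ x in a..b, F x := by
    rw [intervalIntegral.integral_of_le h, integral_Ico_eq_integral_Ioc]
  have hf0 : IntervalIntegrable f volume 0 β⁻¹ :=
    (intervalIntegrable_iff_integrableOn_Ico_of_le hinv0).2
      (hf.mono_set (Ico_subset_Ico le_rfl hinv))
  have hf1 : IntervalIntegrable f volume β⁻¹ 1 :=
    (intervalIntegrable_iff_integrableOn_Ico_of_le hinv).2
      (hf.mono_set (Ico_subset_Ico hinv0 le_rfl))
  have hA : IntegrableOn (fun x => f (x / β)) (Ico 0 1) := by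
    rw [integrableOn_Ico_zero_one_iff]
    have := hf0.comp_mul_right (c := β⁻¹)
    simpa [div_eq_mul_inv, hβ.ne'] using this
  have hB' : IntegrableOn (fun x => f ((x + 1) / β)) (Ico 0 (β - 1)) := by
    rw [← intervalIntegrable_iff_integrableOn_Ico_of_le (by linarith)]
    have := (hf1.comp_mul_right (c := β⁻¹)).comp_add_right 1
    simpa [div_eq_mul_inv, hβ.ne'] using this
  have hset : Ico (0 : ℝ) 1 ∩ Iio (β - 1) = Ico 0 (β - 1) := by
    ext x
    simp only [mem_inter_iff, mem_Ico, mem_Iio]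
    constructor
    · rintro ⟨⟨h1, _⟩, h2⟩; exact ⟨h1, h2⟩
    · rintro ⟨h1, h2⟩; exact ⟨⟨h1, by linarith⟩, h2⟩
  set F : ℝ → ℝ := (Iio (β - 1)).indicator fun x => f ((x + 1) / β) with hF
  have hB : IntegrableOn F (Ico 0 1) := by
    rw [IntegrableOn, hF, integrable_indicator_iff measurableSet_Iio, IntegrableOn,
      Measure.restrict_restrict measurableSet_Iio, inter_comm, hset]
    exact hB'
  have heq : EqOn (fun x => β⁻¹ * (f (x / β) + F x)) (transfer β f) (Ico 0 1) := by
    intro x hx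
    rw [hb.transfer_of_mem_Ico hx]
    simp only [hF, indicator_apply, mem_Iio]
  refine ⟨IntegrableOn.congr_fun (Integrable.const_mul (Integrable.add hA hB) β⁻¹) heq
    measurableSet_Ico, ?_⟩
  rw [← setIntegral_congr_fun measurableSet_Ico heq, integral_const_mul, integral_add hA hB,
    setIntegral_indicator measurableSet_Iio, hset, ico zero_le_one, ico (by linarith),
    ico zero_le_one, intervalIntegral.integral_comp_div _ hβ.ne']
  have h2 : ∫ x in (0 : ℝ)..(β - 1), f ((x + 1) / β) = β • ∫ x in β⁻¹..1, f x := by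
    simp only [add_div]
    rw [intervalIntegral.integral_comp_div_add _ hβ.ne']
    congr 2
    · simp
    · field_simp; ring
  rw [h2, ← smul_add, zero_div, one_div, intervalIntegral.integral_add_adjacent_intervals hf0 hf1,
    smul_eq_mul, inv_mul_cancel_left₀ hβ.ne']

lemma integral_iterate_transfer {f : ℝ → ℝ} (hf : IntegrableOn f (Ico 0 1)) (m : ℕ) :
    IntegrableOn ((transfer β)^[m] f) (Ico 0 1) ∧
      ∫ x in Ico (0 : ℝ) 1, (transfer β)^[m] f x = ∫ x in Ico (0 : ℝ) 1, f x := by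
  induction m with
  | zero => exact ⟨hf, rfl⟩
  | succ m ih =>
    simp only [Function.iterate_succ_apply']
    have := hb.integral_transfer ih.1
    exact ⟨this.1, this.2.trans ih.2⟩

lemma integral_abs_iterate_transfer_le {f : ℝ → ℝ} (hf : IntegrableOn f (Ico 0 1)) (m : ℕ) :
    ∫ x in Ico (0 : ℝ) 1, |(transfer β)^[m] f x| ≤ ∫ x in Ico (0 : ℝ) 1, |f x| := by
  have h := hb.integral_iterate_transfer hf.abs m
  rw [← h.2]
  exact setIntegral_mono_on (hb.integral_iterate_transfer hf m).1.abs h.1 measurableSet_Ico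
    (hb.abs_iterate_transfer_le (fun _ _ => le_rfl) m)

lemma volume_cell (j : ℕ) : volume.real (cell β j) = (β ^ (j + 1))⁻¹ := by
  rw [cell, Real.volume_real_Ico_of_le (hb.strictMono_cut (Nat.lt_succ_self j)).le, cut_succ]
  ring

omit hb in
lemma integrableOn_step (v : ℕ → ℝ) : IntegrableOn (step n β v) (Ico 0 1) := by
  refine integrable_finsetSum _ fun j _ => ?_
  exact (integrable_const (v j)).indicator measurableSet_Ico

lemma integral_step (v : ℕ → ℝ) :
    ∫ x in Ico (0 : ℝ) 1, step n β v x = ∑ j ∈ Finset.range n, v j * (β ^ (j + 1))⁻¹ := by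
  unfold step
  rw [integral_finsetSum (f := fun j => (cell β j).indicator fun _ => v j) _
    fun j _ => (integrable_const (v j)).indicator measurableSet_Ico]
  refine Finset.sum_congr rfl fun j hj => ?_
  rw [setIntegral_indicator (show MeasurableSet (cell β j) from measurableSet_Ico),
    inter_eq_right.2 (hb.cell_subset (Finset.mem_range.1 hj)), setIntegral_const, hb.volume_cell,
    smul_eq_mul, mul_comm]

lemma sum_integral_cell {f : ℝ → ℝ} (hf : IntegrableOn f (Ico 0 1)) :
    ∑ j ∈ Finset.range n, ∫ x in cell β j, f x = ∫ x in Ico (0 : ℝ) 1, f x := by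
  have hle (j : ℕ) : cut β j ≤ cut β (j + 1) := (hb.strictMono_cut (Nat.lt_succ_self j)).le
  have h := intervalIntegral.sum_integral_adjacent_intervals (f := f) (μ := volume)
    (a := cut β) (n := n) fun j hj =>
    (intervalIntegrable_iff_integrableOn_Ico_of_le (hle j)).2 (hf.mono_set (hb.cell_subset hj))
  rw [cut_zero, hb.cut_eq_one, intervalIntegral.integral_of_le zero_le_one,
    ← integral_Ico_eq_integral_Ioc] at h
  rw [← h]
  refine Finset.sum_congr rfl fun j _ => ?_
  rw [intervalIntegral.integral_of_le (hle j), ← integral_Ico_eq_integral_Ioc, cell]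

lemma parryConst_eq :
    parryConst n β = ∑ j ∈ Finset.range n, weight β j * (β ^ (j + 1))⁻¹ := by
  rw [parryConst, parrySum_eq_step, hb.integral_step]

lemma one_le_parryConst : 1 ≤ parryConst n β := by
  have h := setIntegral_mono_on (μ := volume) (s := Ico (0 : ℝ) 1) (f := fun _ => (1 : ℝ))
    (g := parrySum n β) (integrable_const _) (by rw [parrySum_eq_step]; exact integrableOn_step _)
    measurableSet_Ico fun _ hx => hb.one_le_parrySum hx
  simpa [parryConst] using h

/-- The cell has length β^{-(j+1)}, so the subtracted term is the average of F over it. Distance 1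
covers every pair of points in [0,1). -/
lemma abs_sub_average_le {F : ℝ → ℝ} (hF : IntegrableOn F (Ico 0 1)) {E : ℝ}
    (h : OscLE n β F 1 E) {j : ℕ} (hj : j < n) {x : ℝ} (hx : x ∈ cell β j) :
    |F x - β ^ (j + 1) * ∫ y in cell β j, F y| ≤ E * parrySum n β x := by
  have hp : 0 < β ^ (j + 1) := pow_pos hb.pos _
  have hfin : volume (cell β j) < ⊤ := measure_Ico_lt_top
  have h1 : ‖∫ y in cell β j, (F x - F y)‖ ≤ E * parrySum n β x * volume.real (cell β j) := by
    refine norm_setIntegral_le_of_norm_le_const hfin fun y hy => h j hj x hx y hy ?_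
    have hx' := hb.cell_subset hj hx
    have hy' := hb.cell_subset hj hy
    rw [abs_le]
    constructor <;> linarith [hx'.1, hx'.2, hy'.1, hy'.2]
  have h2 : F x - β ^ (j + 1) * ∫ y in cell β j, F y =
      β ^ (j + 1) * ∫ y in cell β j, (F x - F y) := by
    rw [integral_sub (integrableOn_const (C := F x) hfin.ne)
      (hF.mono_set (hb.cell_subset hj)),
      setIntegral_const, hb.volume_cell, smul_eq_mul, mul_sub, mul_inv_cancel_left₀ hp.ne']
  rw [h2, abs_mul, abs_of_pos hp]
  rw [hb.volume_cell, Real.norm_eq_abs] at h1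
  calc _ ≤ β ^ (j + 1) * (E * parrySum n β x * (β ^ (j + 1))⁻¹) :=
        mul_le_mul_of_nonneg_left h1 hp.le
    _ = _ := by field_simp

/-! ### The convergence rate. -/

/-- The convergence rate for functions with a bound on the oscillation. -/
theorem exists_rate {l : ℂ} (hl : IsSecondRoot n l) :
    ∃ C : ℝ, 0 ≤ C ∧ ∀ g : ℝ → ℝ, IntegrableOn g (Ico 0 1) → ∀ (m₁ m₂ : ℕ) (E : ℝ), 0 ≤ E →
      OscLE n β g (β ^ m₁)⁻¹ E → ∀ x ∈ Ico (0 : ℝ) 1,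
        |(transfer β)^[m₁ + m₂] g x - (∫ y in Ico (0 : ℝ) 1, g y) * parryDensity n β x| ≤
          C * (∫ y in Ico (0 : ℝ) 1, |g y|) * (β⁻¹ * ‖l‖) ^ m₂ + E * β ^ n := by
  obtain ⟨C, hC, hbound⟩ := hb.exists_shift_bound hl
  refine ⟨C * (2 * β ^ n), by have := hb.pos; positivity, fun g hg m₁ m₂ E hE hosc x hx => ?_⟩
  have hβ := hb.pos
  set N := ∫ y in Ico (0 : ℝ) 1, |g y|
  set I := ∫ y in Ico (0 : ℝ) 1, g y
  set D := parryConst n β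
  have hD : 1 ≤ D := hb.one_le_parryConst
  set F := (transfer β)^[m₁] g
  have hF := hb.integral_iterate_transfer hg m₁
  have hFN : ∫ y in Ico (0 : ℝ) 1, |F y| ≤ N := hb.integral_abs_iterate_transfer_le hg m₁
  have hIN : |I| ≤ N := abs_integral_le_integral_abs
  have hoscF : OscLE n β F 1 E := by
    have := hb.oscLE_iterate_transfer hosc m₁
    rwa [mul_inv_cancel₀ (pow_pos hβ _).ne'] at this
  set a : ℕ → ℝ := fun j => β ^ (j + 1) * ∫ y in cell β j, F y
  -- The cell averages with their invariant component removed: the integral becomes zero, so the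
  -- spectral bound applies. The factor 2β^n in the constant bounds |w j| relative to N.
  set w : ℕ → ℝ := fun j => a j - I / D * weight β j
  have haN (j : ℕ) (hj : j < n) : |a j| ≤ β ^ n * N := by
    rw [abs_mul, abs_of_pos (pow_pos hβ _)]
    refine mul_le_mul (pow_le_pow_right₀ hb.one_lt.le hj) ?_ (abs_nonneg _) (pow_pos hβ _).le
    refine abs_integral_le_integral_abs.trans (le_trans ?_ hFN)
    exact setIntegral_mono_set hF.1.abs (ae_of_all _ fun _ => abs_nonneg _)
      (hb.cell_subset hj).eventuallyLE
  have hwN (j : ℕ) (hj : j < n) : |w j| ≤ 2 * β ^ n * N := by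
    have h1 : |I / D * weight β j| ≤ N * β ^ n := by
      rw [abs_mul, abs_div, abs_of_pos (by linarith : 0 < D)]
      refine mul_le_mul ((div_le_self (abs_nonneg _) hD).trans hIN) ?_ (abs_nonneg _)
        ((abs_nonneg _).trans hIN)
      rw [abs_of_nonneg (by linarith [hb.one_le_weight hj])]
      exact hb.weight_le hj
    have := abs_sub (a j) (I / D * weight β j)
    linarith [haN j hj]
  have hw0 : ∑ j ∈ Finset.range n, w j * (β ^ (j + 1))⁻¹ = 0 := by
    have h1 : ∑ j ∈ Finset.range n, a j * (β ^ (j + 1))⁻¹ = I := by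
      refine Eq.trans ?_ ((hb.sum_integral_cell hF.1).trans hF.2)
      refine Finset.sum_congr rfl fun j _ => ?_
      have := (pow_pos hβ (j + 1)).ne'
      simp only [a]
      field_simp
      rfl
    simp only [w, sub_mul, Finset.sum_sub_distrib, mul_assoc]
    rw [h1, ← Finset.mul_sum, ← hb.parryConst_eq]
    change I - I / D * D = 0
    rw [div_mul_cancel₀ _ (by linarith), sub_self]
  -- Deviation from the averages, decaying part, invariant part; only differences and scalar
  -- multiples occur, to match the linearity lemmas for the iterates.
  have hdecomp : EqOn F ((F - step n β a) - ((-1 : ℝ) • step n β w - (I / D) • parrySum n β))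
      (Ico 0 1) := by
    intro y hy
    obtain ⟨j, hj, hyj⟩ := hb.exists_mem_cell hy
    simp only [Pi.sub_apply, Pi.smul_apply, smul_eq_mul, parrySum_eq_step,
      hb.step_of_mem hj hyj, w]
    ring
  have hT : (transfer β)^[m₁ + m₂] g x = (transfer β)^[m₂] (F - step n β a) x +
      (β⁻¹ ^ m₂) * step n β ((shift n)^[m₂] w) x + I / D * parrySum n β x := by
    rw [add_comm m₁ m₂, Function.iterate_add_apply, hb.iterate_transfer_congr hdecomp m₂ hx,
      iterate_transfer_sub, iterate_transfer_sub β ((-1 : ℝ) • _), iterate_transfer_smul,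
      iterate_transfer_smul]
    simp only [Pi.sub_apply, Pi.smul_apply, smul_eq_mul]
    rw [hb.iterate_transfer_parrySum m₂ hx, hb.iterate_transfer_step w m₂ hx]
    simp only [Pi.smul_apply, smul_eq_mul]
    ring
  have h1 : |(transfer β)^[m₂] (F - step n β a) x| ≤ E * β ^ n := by
    have := hb.abs_iterate_transfer_le (f := F - step n β a) (g := E • parrySum n β)
      (fun y hy => by
        obtain ⟨j, hj, hyj⟩ := hb.exists_mem_cell hy
        simp only [Pi.sub_apply, Pi.smul_apply, smul_eq_mul, hb.step_of_mem hj hyj]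
        exact hb.abs_sub_average_le hF.1 hoscF hj hyj) m₂ x hx
    rw [iterate_transfer_smul, Pi.smul_apply, smul_eq_mul, hb.iterate_transfer_parrySum m₂ hx] at this
    exact this.trans (mul_le_mul_of_nonneg_left (hb.parrySum_le hx) hE)
  have h2 : |(β⁻¹ ^ m₂) * step n β ((shift n)^[m₂] w) x| ≤
      C * (2 * β ^ n) * N * (β⁻¹ * ‖l‖) ^ m₂ := by
    obtain ⟨j, hj, hxj⟩ := hb.exists_mem_cell hx
    have hp : 0 < β⁻¹ ^ m₂ := pow_pos (inv_pos.2 hβ) _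
    rw [hb.step_of_mem hj hxj, abs_mul, abs_of_pos hp]
    refine (mul_le_mul_of_nonneg_left (hbound w _ hwN hw0 m₂ j hj) hp.le).trans_eq ?_
    rw [mul_pow]; ring
  have h3 : (transfer β)^[m₁ + m₂] g x - I * parryDensity n β x =
      (β⁻¹ ^ m₂) * step n β ((shift n)^[m₂] w) x + (transfer β)^[m₂] (F - step n β a) x := by
    rw [hT, parryDensity]
    change _ - I * (_ / D) = _
    ring
  rw [h3]
  exact (abs_add_le _ _).trans (add_le_add h2 h1)

end IsBase

/-! ### Densities, their laws and total variation. -/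

lemma tvDist_nonneg (μ ν : Measure ℝ) : 0 ≤ tvDist μ ν := by
  refine Real.sSup_nonneg ?_
  rintro _ ⟨B, -, -, rfl⟩
  exact abs_nonneg _

namespace IsPDF

variable {f g : ℝ → ℝ}

lemma ae_nonneg (hf : IsPDF f) : 0 ≤ᵐ[volume.restrict (Ico (0 : ℝ) 1)] f :=
  (ae_restrict_iff' measurableSet_Ico).2 (ae_of_all _ hf.nonneg)

lemma integrableOn (hf : IsPDF f) : IntegrableOn f (Ico 0 1) := by
  refine ⟨hf.measurable.aestronglyMeasurable, ?_⟩
  rw [hasFiniteIntegral_iff_ofReal hf.ae_nonneg, hf.lintegral_eq_one]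
  exact ENNReal.one_lt_top

lemma integral_eq_one (hf : IsPDF f) : ∫ x in Ico (0 : ℝ) 1, f x = 1 := by
  rw [integral_eq_lintegral_of_nonneg_ae hf.ae_nonneg hf.measurable.aestronglyMeasurable,
    hf.lintegral_eq_one, ENNReal.toReal_one]

lemma integral_abs_eq_one (hf : IsPDF f) : ∫ x in Ico (0 : ℝ) 1, |f x| = 1 := by
  refine Eq.trans ?_ hf.integral_eq_one
  exact setIntegral_congr_fun measurableSet_Ico fun x hx => abs_of_nonneg (hf.nonneg x hx)

lemma of_integral_eq_one (hm : Measurable f) (h0 : ∀ x ∈ Ico (0 : ℝ) 1, 0 ≤ f x)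
    (h1 : ∫ x in Ico (0 : ℝ) 1, f x = 1) : IsPDF f := by
  refine ⟨hm, h0, ?_⟩
  have hi : IntegrableOn f (Ico 0 1) := by
    -- The integral of a non-integrable function is 0 by convention, so the value 1 forces
    -- integrability.
    by_contra h
    rw [integral_undef h] at h1
    exact zero_ne_one h1
  rw [← ofReal_integral_eq_lintegral_ofReal hi
    ((ae_restrict_iff' measurableSet_Ico).2 (ae_of_all _ h0)), h1, ENNReal.ofReal_one]

lemma densityLaw_apply (hf : IsPDF f) {B : Set ℝ} (hB : MeasurableSet B) :
    densityLaw f B = ENNReal.ofReal (∫ x in Ico (0 : ℝ) 1, B.indicator f x) := by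
  rw [densityLaw, withDensity_apply _ hB, integral_indicator hB,
    ofReal_integral_eq_lintegral_ofReal]
  · exact Integrable.restrict hf.integrableOn
  · exact ae_restrict_of_ae hf.ae_nonneg

lemma densityLaw_real (hf : IsPDF f) {B : Set ℝ} (hB : MeasurableSet B) :
    (densityLaw f).real B = ∫ x in Ico (0 : ℝ) 1, B.indicator f x := by
  rw [measureReal_def, hf.densityLaw_apply hB, ENNReal.toReal_ofReal]
  exact setIntegral_nonneg measurableSet_Ico fun x hx =>
    indicator_apply_nonneg fun _ => hf.nonneg x hx

lemma tvDist_densityLaw_le (hf : IsPDF f) (hg : IsPDF g) :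
    tvDist (densityLaw f) (densityLaw g) ≤ ∫ x in Ico (0 : ℝ) 1, |f x - g x| := by
  refine Real.sSup_le ?_ (integral_nonneg fun _ => abs_nonneg _)
  rintro _ ⟨B, hB, -, rfl⟩
  rw [hf.densityLaw_real hB, hg.densityLaw_real hB,
    ← integral_sub (hf.integrableOn.indicator hB) (hg.integrableOn.indicator hB)]
  refine abs_integral_le_integral_abs.trans
    (integral_mono ((hf.integrableOn.indicator hB).sub (hg.integrableOn.indicator hB)).abs
      (Integrable.abs (Integrable.sub hf.integrableOn hg.integrableOn)) fun x => ?_)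
  by_cases h : x ∈ B <;> simp [h]

end IsPDF

namespace IsBase

variable {n : ℕ} {β : ℝ} (hb : IsBase n β)
include hb

lemma betaMap_add_div {x : ℝ} (hx : x ∈ Ico (0 : ℝ) 1) (k : ℤ) : betaMap β ((x + k) / β) = x := by
  have h : ⌊x⌋ = 0 := Int.floor_eq_zero_iff.2 hx
  rw [betaMap, mul_div_cancel₀ _ hb.pos.ne', Int.floor_add_intCast, h]
  simp

/-- Both branches are right inverses of t, so the indicator factors out of T. As T preserves
integrals, t then pushes the law of f to that of Tf. -/
lemma transfer_indicator_preimage (f : ℝ → ℝ) (B : Set ℝ) :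
    EqOn (transfer β ((betaMap β ⁻¹' B).indicator f)) (B.indicator (transfer β f)) (Ico 0 1) := by
  intro x hx
  have h0 : betaMap β (x / β) = x := by simpa using hb.betaMap_add_div hx 0
  have h1 : betaMap β ((x + 1) / β) = x := by simpa using hb.betaMap_add_div hx 1
  rw [hb.transfer_of_mem_Ico hx]
  by_cases h : x ∈ B
  · simp [h0, h1, h, hb.transfer_of_mem_Ico hx]
  · simp [h0, h1, h]

lemma isPDF_transfer {f : ℝ → ℝ} (hf : IsPDF f) : IsPDF (transfer β f) :=
  .of_integral_eq_one (measurable_transfer β hf.measurable) (hb.transfer_nonneg hf.nonneg)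
    ((hb.integral_transfer hf.integrableOn).2.trans hf.integral_eq_one)

lemma measurePreserving_betaMap {f : ℝ → ℝ} (hf : IsPDF f) :
    MeasurePreserving (betaMap β) (densityLaw f) (densityLaw (transfer β f)) := by
  refine ⟨measurable_betaMap β, ?_⟩
  ext B hB
  have hB' : MeasurableSet (betaMap β ⁻¹' B) := measurable_betaMap β hB
  rw [Measure.map_apply (measurable_betaMap β) hB, hf.densityLaw_apply hB',
    (hb.isPDF_transfer hf).densityLaw_apply hB,
    ← (hb.integral_transfer (hf.integrableOn.indicator hB')).2,
    setIntegral_congr_fun measurableSet_Ico (hb.transfer_indicator_preimage f B)]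

lemma isPDF_iterate_transfer {f : ℝ → ℝ} (hf : IsPDF f) (m : ℕ) : IsPDF ((transfer β)^[m] f) := by
  induction m with
  | zero => exact hf
  | succ m ih => rw [Function.iterate_succ_apply']; exact hb.isPDF_transfer ih

lemma measurePreserving_iterate_betaMap {f : ℝ → ℝ} (hf : IsPDF f) (m : ℕ) :
    MeasurePreserving (betaMap β)^[m] (densityLaw f) (densityLaw ((transfer β)^[m] f)) := by
  induction m with
  | zero => exact .id _
  | succ m ih =>
    rw [Function.iterate_succ_apply', Function.iterate_succ']
    exact (hb.measurePreserving_betaMap (hb.isPDF_iterate_transfer hf m)).comp ih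

lemma isPDF_parryDensity : IsPDF (parryDensity n β) := by
  have hD := hb.one_le_parryConst
  refine .of_integral_eq_one ?_ (fun x hx => ?_) ?_
  · unfold parryDensity
    rw [parrySum_eq_step]
    exact (measurable_step n β _).div_const _
  · exact div_nonneg (by linarith [hb.one_le_parrySum hx]) (by linarith)
  · unfold parryDensity
    rw [integral_div]
    exact div_self (by change parryConst n β ≠ 0; linarith)

lemma transfer_parryDensity : EqOn (transfer β (parryDensity n β)) (parryDensity n β) (Ico 0 1) := by
  have h : parryDensity n β = (parryConst n β)⁻¹ • parrySum n β := by
    funext x; simp [parryDensity, div_eq_inv_mul]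
  intro x hx
  rw [h, transfer_smul, Pi.smul_apply, Pi.smul_apply, hb.transfer_parrySum hx]

omit hb in
lemma densityLaw_congr {f g : ℝ → ℝ} (h : EqOn f g (Ico 0 1)) : densityLaw f = densityLaw g :=
  withDensity_congr_ae ((ae_restrict_iff' measurableSet_Ico).2 (ae_of_all _ fun _ hx =>
    congrArg ENNReal.ofReal (h hx)))

lemma measurePreserving_parryDensity :
    MeasurePreserving (betaMap β) (densityLaw (parryDensity n β))
      (densityLaw (parryDensity n β)) := by
  have h := hb.measurePreserving_betaMap hb.isPDF_parryDensity
  rwa [densityLaw_congr hb.transfer_parryDensity] at h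

/-! ### The digit expansion of the scaled remainder. -/

lemma iterate_betaMap_eq_sum (x : ℝ) (m N : ℕ) :
    (betaMap β)^[m] x = ∑ k ∈ Finset.range N, (digit β (m + k) x : ℝ) * (β ^ (k + 1))⁻¹ +
      (β ^ N)⁻¹ * (betaMap β)^[m + N] x := by
  have hβ := hb.pos.ne'
  induction N with
  | zero => simp
  | succ N ih =>
    have h : (betaMap β)^[m + (N + 1)] x =
        β * (betaMap β)^[m + N] x - (digit β (m + N) x : ℝ) := by
      rw [← add_assoc, Function.iterate_succ_apply']; rfl
    rw [ih, Finset.sum_range_succ, h, pow_succ]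
    field_simp
    ring

lemma hasSum_digit {x : ℝ} (hx : x ∈ Ico (0 : ℝ) 1) (m : ℕ) :
    HasSum (fun k : ℕ => (digit β (m + k) x : ℝ) * (β ^ (k + 1))⁻¹) ((betaMap β)^[m] x) := by
  have hmem (k : ℕ) : (betaMap β)^[k] x ∈ Ico (0 : ℝ) 1 := by
    cases k with
    | zero => exact hx
    | succ k => rw [Function.iterate_succ_apply']; exact betaMap_mem _ _
  rw [hasSum_iff_tendsto_nat_of_nonneg]
  · have h0 : Tendsto (fun N : ℕ => (β ^ N)⁻¹ * (betaMap β)^[m + N] x) atTop (𝓝 0) := by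
      have h1 : Tendsto (fun N : ℕ => β⁻¹ ^ N) atTop (𝓝 0) :=
        tendsto_pow_atTop_nhds_zero_of_lt_one (inv_pos.2 hb.pos).le (inv_lt_one_of_one_lt₀ hb.one_lt)
      refine squeeze_zero (fun N => mul_nonneg (inv_pos.2 (pow_pos hb.pos N)).le (hmem _).1)
        (fun N => ?_) h1
      rw [inv_pow]
      exact mul_le_of_le_one_right (inv_pos.2 (pow_pos hb.pos N)).le (hmem _).2.le
    have h2 := h0.const_sub ((betaMap β)^[m] x)
    rw [sub_zero] at h2
    refine h2.congr fun N => ?_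
    have := hb.iterate_betaMap_eq_sum x m N
    linarith
  · intro k
    have h1 : 0 ≤ digit β (m + k) x := Int.floor_nonneg.2 (mul_nonneg hb.pos.le (hmem _).1)
    exact mul_nonneg (by exact_mod_cast h1) (inv_pos.2 (pow_pos hb.pos _)).le

/-! ### L¹ convergence for arbitrary densities. -/

lemma tendsto_integral_abs_sub {l : ℂ} (hl : IsSecondRoot n l) {f : ℝ → ℝ} (hf : IsPDF f) :
    Tendsto (fun m : ℕ => ∫ x in Ico (0 : ℝ) 1, |(transfer β)^[m] f x - parryDensity n β x|)
      atTop (𝓝 0) := by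
  have hβ := hb.pos
  obtain ⟨C, hC, hrate⟩ := hb.exists_rate hl
  have hq0 : 0 ≤ β⁻¹ * ‖l‖ := by positivity
  have hq1 : β⁻¹ * ‖l‖ < 1 := by
    rw [inv_mul_lt_iff₀ hβ, mul_one]; exact (hb.exists_roots hl).1
  rw [Metric.tendsto_atTop]
  intro ε hε
  -- A continuous compactly supported g is uniformly continuous, which supplies the oscillation
  -- bound. Its integral I need not be 1; the defect is at most ε/8.
  obtain ⟨g, hgs, hfg, hgc, hgi⟩ := Integrable.exists_hasCompactSupport_integral_sub_le
    ((integrable_indicator_iff measurableSet_Ico).2 hf.integrableOn)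
    (by positivity : (0 : ℝ) < ε / 8)
  have hg : IntegrableOn g (Ico 0 1) := hgi.integrableOn
  have hfgi : IntegrableOn (f - g) (Ico 0 1) := Integrable.sub hf.integrableOn hg
  have hfg' : ∫ x in Ico (0 : ℝ) 1, |(f - g) x| ≤ ε / 8 := by
    refine le_trans ?_ hfg
    have h1 : ∫ x in Ico (0 : ℝ) 1, |(f - g) x| =
        ∫ x in Ico (0 : ℝ) 1, ‖(Ico (0 : ℝ) 1).indicator f x - g x‖ :=
      setIntegral_congr_fun measurableSet_Ico fun x hx => by
        simp only [indicator_of_mem hx, Pi.sub_apply, Real.norm_eq_abs]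
    rw [h1]
    exact setIntegral_le_integral
      (((integrable_indicator_iff measurableSet_Ico).2 hf.integrableOn).sub hgi).norm
      (ae_of_all _ fun _ => norm_nonneg _)
  set N := ∫ x in Ico (0 : ℝ) 1, |g x|
  set I := ∫ x in Ico (0 : ℝ) 1, g x
  have hI : |1 - I| ≤ ε / 8 := by
    rw [← hf.integral_eq_one, ← integral_sub hf.integrableOn hg]
    exact abs_integral_le_integral_abs.trans hfg'
  set E := ε / 8 / β ^ n with hE
  have hE0 : 0 < E := by positivity
  obtain ⟨δ, hδ, hδg⟩ := Metric.uniformContinuous_iff.1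
    (hgs.uniformContinuous_of_continuous hgc) E hE0
  obtain ⟨m₁, hm₁⟩ := exists_pow_lt_of_lt_one hδ (inv_lt_one_of_one_lt₀ hb.one_lt)
  rw [inv_pow] at hm₁
  have hosc : OscLE n β g (β ^ m₁)⁻¹ E := fun j hj x hx y _ hxy =>
    (hδg (hxy.trans_lt hm₁)).le.trans
      (le_mul_of_one_le_right hE0.le (hb.one_le_parrySum (hb.cell_subset hj hx)))
  have hlim : Tendsto (fun m : ℕ => C * N * (β⁻¹ * ‖l‖) ^ m) atTop (𝓝 0) := by
    simpa using (tendsto_pow_atTop_nhds_zero_of_lt_one hq0 hq1).const_mul (C * N)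
  obtain ⟨M, hM⟩ := eventually_atTop.1 (hlim.eventually_lt_const (by positivity : 0 < ε / 8))
  refine ⟨m₁ + M, fun m hm => ?_⟩
  obtain ⟨m₂, rfl⟩ : ∃ m₂, m = m₁ + m₂ := ⟨m - m₁, by omega⟩
  have hpt : ∀ x ∈ Ico (0 : ℝ) 1, |(transfer β)^[m₁ + m₂] f x - parryDensity n β x| ≤
      |(transfer β)^[m₁ + m₂] (f - g) x| + ε / 4 + ε / 8 * parryDensity n β x := by
    intro x hx
    have h1 := hrate g hg m₁ m₂ E hE0.le hosc x hx
    have h2 := hM m₂ (by omega)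
    have h3 : E * β ^ n = ε / 8 := by rw [hE]; field_simp
    have hp := hb.isPDF_parryDensity.nonneg x hx
    have h4 : |(1 - I) * parryDensity n β x| ≤ ε / 8 * parryDensity n β x := by
      rw [abs_mul, abs_of_nonneg hp]
      exact mul_le_mul_of_nonneg_right hI hp
    have h5 : (transfer β)^[m₁ + m₂] f x - parryDensity n β x =
        (transfer β)^[m₁ + m₂] (f - g) x + ((transfer β)^[m₁ + m₂] g x - I * parryDensity n β x) -
          (1 - I) * parryDensity n β x := by
      rw [iterate_transfer_sub, Pi.sub_apply]; ring
    rw [h5]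
    refine (abs_sub _ _).trans (add_le_add ((abs_add_le _ _).trans (add_le_add le_rfl ?_)) h4)
    rw [h3] at h1
    exact h1.trans (by linarith)
  have hT := (hb.integral_iterate_transfer hfgi (m₁ + m₂)).1.abs
  have hP := hb.isPDF_parryDensity
  have hc : IntegrableOn (fun _ : ℝ => ε / 4) (Ico 0 1) := integrable_const _
  -- Respectively: L¹ contraction applied to f - g, the rate for g (ε/8 each from decay and
  -- oscillation), and the defect 1 - I.
  have hbd : ∫ x in Ico (0 : ℝ) 1, |(transfer β)^[m₁ + m₂] f x - parryDensity n β x| ≤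
      ε / 8 + ε / 4 + ε / 8 := by
    refine (setIntegral_mono_on (Integrable.abs (Integrable.sub
      (hb.isPDF_iterate_transfer hf _).integrableOn hP.integrableOn))
      (Integrable.add (Integrable.add hT hc) (Integrable.const_mul hP.integrableOn (ε / 8)))
      measurableSet_Ico hpt).trans ?_
    rw [integral_add' (Integrable.add hT hc) (Integrable.const_mul hP.integrableOn (ε / 8)),
      integral_add' hT hc, integral_const_mul, hP.integral_eq_one, mul_one]
    have := (hb.integral_abs_iterate_transfer_le hfgi (m₁ + m₂)).trans hfg'
    simpa using this
  rw [Real.dist_eq, sub_zero, abs_of_nonneg (integral_nonneg fun _ => abs_nonneg _)]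
  linarith

end IsBase

end

end PseudoGolden

open PseudoGolden
theorem theorem1 (n : ℕ) (hn : 2 ≤ n) (β : ℝ) (hβ_pos : 0 < β)
    (hβ : β ^ n = ∑ i ∈ Finset.range n, β ^ i)
    (lam₂ : ℂ) (hlam₂ : IsSecondRoot n lam₂) :
    -- the scaled remainder `t^m(x)` is the series of the shifted digits
    (∀ x ∈ Ico (0 : ℝ) 1, ∀ m : ℕ,
      HasSum (fun k : ℕ => (digit β (m + k) x : ℝ) * (β ^ (k + 1))⁻¹) ((betaMap β)^[m] x)) ∧
    -- `f_β` is a probability density, and its law `P_β` is invariant under `t`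
    IsPDF (parryDensity n β) ∧
    MeasurePreserving (betaMap β) (densityLaw (parryDensity n β))
      (densityLaw (parryDensity n β)) ∧
    -- `f_m = T^m f` is a density of `t^m(X)`, and the law of `t^m(X)` converges to `P_β`
    (∀ (Ω : Type*) [MeasurableSpace Ω] (P : Measure Ω) [IsProbabilityMeasure P]
      (X : Ω → ℝ) (f : ℝ → ℝ), IsPDF f → HasLaw X (densityLaw f) P →
      (∀ m : ℕ, IsPDF ((transfer β)^[m] f) ∧
        HasLaw (fun ω => (betaMap β)^[m] (X ω)) (densityLaw ((transfer β)^[m] f)) P) ∧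
      Tendsto (fun m : ℕ => tvDist (P.map fun ω => (betaMap β)^[m] (X ω))
        (densityLaw (parryDensity n β))) atTop (𝓝 0)) ∧
    -- the rate for Lipschitz densities, with constants that depend only on `n`
    (∃ C₁ C₂ : ℝ, ∀ (f : ℝ → ℝ) (L : ℝ), IsPDF f →
      (∀ x ∈ Ico (0 : ℝ) 1, ∀ y ∈ Ico (0 : ℝ) 1, |f x - f y| ≤ L * |x - y|) →
      ∀ m m₁ m₂ : ℕ, m₁ + m₂ = m → 2 * n - 1 < m₂ → n - 1 ≤ m₁ →
        ∀ x ∈ Ico (0 : ℝ) 1,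
          |(transfer β)^[m] f x - parryDensity n β x| ≤
            C₁ * ‖(β : ℂ)⁻¹ * lam₂‖ ^ m₂ + C₂ * (β ^ m₁)⁻¹ * L) := by
  have hb : IsBase n β := ⟨hn, hβ_pos, hβ⟩
  refine ⟨fun x hx m => hb.hasSum_digit hx m, hb.isPDF_parryDensity,
    hb.measurePreserving_parryDensity, fun Ω _ P _ X f hf hX => ⟨fun m =>
      ⟨hb.isPDF_iterate_transfer hf m,
        (hb.measurePreserving_iterate_betaMap hf m).fun_comp_hasLaw hX⟩, ?_⟩, ?_⟩
  · refine squeeze_zero (fun m => tvDist_nonneg _ _) (fun m => ?_)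
      (hb.tendsto_integral_abs_sub hlam₂ hf)
    rw [((hb.measurePreserving_iterate_betaMap hf m).fun_comp_hasLaw hX).map_eq]
    exact (hb.isPDF_iterate_transfer hf m).tvDist_densityLaw_le hb.isPDF_parryDensity
  · obtain ⟨C, -, hrate⟩ := hb.exists_rate hlam₂
    -- β^n is the upper bound of the unnormalized density that multiplies the oscillation error.
    refine ⟨C, β ^ n, fun f L hf hL m m₁ m₂ hm _ _ x hx => ?_⟩
    have hp : 0 < (β ^ m₁)⁻¹ := inv_pos.2 (pow_pos hβ_pos _)
    have hL0 : 0 ≤ L := by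
      have := (abs_nonneg _).trans (hL 0 (by norm_num) (1 / 2) (by norm_num))
      norm_num at this
      exact this
    -- The Lipschitz bound at distance β^{-m₁}; the unnormalized density is at least 1, so inserting
    -- it as a factor is harmless.
    have hosc : OscLE n β f (β ^ m₁)⁻¹ (L * (β ^ m₁)⁻¹) := by
      intro j hj x hx y hy hxy
      have hx' := hb.cell_subset hj hx
      refine (hL x hx' y (hb.cell_subset hj hy)).trans ?_
      exact (mul_le_mul_of_nonneg_left hxy hL0).trans
        (le_mul_of_one_le_right (mul_nonneg hL0 hp.le) (hb.one_le_parrySum hx'))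
    have h := hrate f hf.integrableOn m₁ m₂ _ (mul_nonneg hL0 hp.le) hosc x hx
    rw [hf.integral_eq_one, hf.integral_abs_eq_one, hm, one_mul, mul_one] at h
    have hnorm : ‖(β : ℂ)⁻¹ * lam₂‖ = β⁻¹ * ‖lam₂‖ := by
      rw [norm_mul, norm_inv, Complex.norm_of_nonneg hβ_pos.le]
    rw [hnorm]
    refine h.trans_eq ?_
    ring
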